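/- Consider $N$ sporadic tasks $\tau_1,\dots,\tau_N$ with arbitrary relative deadlines on $M\ge 2$ identical processors under global fixed-priority preemptive scheduling, where $\tau_i$ has higher priority than $\tau_j$ if $i<j$. Task $\tau_i$ has worst-case execution time $C_i>0$, relative deadline $D_i>0$ and minimum inter-arrival time $T_i>0$, with $C_i/D_i\le 1$ and $U_i:=C_i/T_i\le 1$. At each instant the (at most) $M$ ready jobs of highest priority are executed; the jobs of one task are executed sequentially, in order of arrival. A task is schedulable if, for every admissible job sequence of the task set, all jobs of this task finish by their absolute deadlines. Fix $k$ and suppose that $\tau_1,\dots,\tau_{k-1}$ are schedulable. For an integer $\ell\ge 1$ put $D_k'=(\ell-1)T_k+D_k$. Suppose that for every integer $\ell\ge 1$ there is a real $\rho$ with $\ell C_k/D_k'\le\rho\le 1$ such that $$\frac{\ell C_k}{D_k'}+\sum_{\tau_i\in\mathbf T^{\mathrm{carry\text{-}approx}}}\frac{\gamma_iU_iD_i}{D_k'}+\sum_{i=1}^{k-1}\left(\frac{C_i-C_iU_i}{D_k'}+U_i\right)\le\mu_k,\qquad \mu_k:=M-(M-1)\rho,$$ where $\gamma_i=1$ if $U_i>\rho$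 and $\gamma_i=0$ if $U_i\le\rho$, and $\mathbf T^{\mathrm{carry\text{-}approx}}$ is the set of the $\lceil\mu_k\rceil-1$ tasks among $\tau_1,\dots,\tau_{k-1}$ with the largest values of $\gamma_iU_iD_i$ (if fewer than $\lceil\mu_k\rceil-1$ of these tasks have $U_i>\rho$, it is the set of all those that do). Then $\tau_k$ is schedulable. If $D_k\le T_k$, it suffices that this condition holds for $\ell=1$. -/

import Mathlib

open MeasureTheory

noncomputable section

/-- A sporadic task: worst-case execution time `C`, relative deadline `D`, minimum inter-arrival
time `T`, all positive, with `C / D ≤ 1` and utilization `C / T ≤ 1`.  No relation between `D`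
and `T` is imposed (arbitrary deadlines). -/
structure SporadicTask where
  C : ℝ
  D : ℝ
  T : ℝ
  C_pos : 0 < C
  D_pos : 0 < D
  T_pos : 0 < T
  C_le_D : C / D ≤ 1
  C_le_T : C / T ≤ 1

namespace SporadicTask

/-- Utilization `U = C / T`. -/
def U (a : SporadicTask) : ℝ := a.C / a.T

end SporadicTask

/-- A job sequence of the task set `τ`: `arr i j` is the arrival time and `cost i j` the actual
execution time of the `j`-th job (`j = 0, 1, …`) of task `i`.  The system starts at time `0`,
consecutive arrivals of one task are at least `T` apart, and no job runs longer than `C`. -/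
structure JobSequence {N : ℕ} (τ : Fin N → SporadicTask) where
  arr : Fin N → ℕ → ℝ
  cost : Fin N → ℕ → ℝ
  arr_nonneg : ∀ i j, 0 ≤ arr i j
  arr_sep : ∀ i j, arr i j + (τ i).T ≤ arr i (j + 1)
  cost_nonneg : ∀ i j, 0 ≤ cost i j
  cost_le : ∀ i j, cost i j ≤ (τ i).C

namespace JobSequence

variable {N : ℕ} {τ : Fin N → SporadicTask}

/-- The amount of service that job `j` of task `i` has received before time `t`, in the execution
pattern where `exec i j` is the set of time instants at which that job is executed. -/
def service (exec : Fin N → ℕ → Set ℝ) (i : Fin N) (j : ℕ) (t : ℝ) : ℝ :=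
  (volume (exec i j ∩ Set.Ico 0 t)).toReal

/-- Job `j` of task `i` has arrived before or at `t` and has not finished yet at `t`. -/
def Pending (J : JobSequence τ) (exec : Fin N → ℕ → Set ℝ) (i : Fin N) (j : ℕ) (t : ℝ) : Prop :=
  J.arr i j ≤ t ∧ service exec i j t < J.cost i j

/-- Task `i` is active at `t`: at least one of its jobs is pending. -/
def Active (J : JobSequence τ) (exec : Fin N → ℕ → Set ℝ) (i : Fin N) (t : ℝ) : Prop :=
  ∃ j, J.Pending exec i j t

/-- `exec` is the schedule of the jobs `J` on `M` identical unit-speed processors under global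
fixed-priority preemptive scheduling, a smaller task index meaning a higher priority.  The jobs of
one task are served sequentially and in order of arrival, so the ready queue holds the earliest
pending job of every active task; at each instant exactly the `M` ready jobs of highest priority
(all of them, if there are fewer than `M`) are executed.  Jobs migrate freely between processors,
so that only the set of executed jobs matters. -/
structure IsGlobalFPSchedule (J : JobSequence τ) (M : ℕ) (exec : Fin N → ℕ → Set ℝ) : Prop where
  measurable : ∀ i j, MeasurableSet (exec i j)
  exec_iff : ∀ i j t, t ∈ exec i j ↔
    J.Pending exec i j t ∧ (∀ j' < j, ¬ J.Pending exec i j' t) ∧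
      {i' : Fin N | i' < i ∧ J.Active exec i' t}.ncard < M

/-- Job `j` of task `i` has finished by its absolute deadline. -/
def MeetsDeadline (J : JobSequence τ) (exec : Fin N → ℕ → Set ℝ) (i : Fin N) (j : ℕ) : Prop :=
  J.cost i j ≤ service exec i j (J.arr i j + (τ i).D)

end JobSequence

/-- Task `i` of the task set `τ` is schedulable by global fixed-priority preemptive scheduling on
`M` processors: whatever job sequence the tasks release, every job of task `i` meets its deadline
(the worst-case response time of task `i` is at most its relative deadline). -/
def Schedulable {N : ℕ} (M : ℕ) (τ : Fin N → SporadicTask) (i : Fin N) : Prop :=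
  ∀ (J : JobSequence τ) (exec : Fin N → ℕ → Set ℝ), J.IsGlobalFPSchedule M exec →
    ∀ j, J.MeetsDeadline exec i j

/-- `μ = M - (M - 1) ρ`. -/
def muVal (M : ℕ) (ρ : ℝ) : ℝ := (M : ℝ) - ((M : ℝ) - 1) * ρ

open Classical in
/-- `γ = 1` if `U > ρ`, and `γ = 0` if `U ≤ ρ`. -/
def gammaVal (a : SporadicTask) (ρ : ℝ) : ℝ := if ρ < a.U then 1 else 0

/-- `D' = (ℓ - 1) T + D`. -/
def dPrime (a : SporadicTask) (ℓ : ℕ) : ℝ := ((ℓ : ℝ) - 1) * a.T + a.D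

/-- `S` consists of `⌈μ⌉ - 1` tasks among the tasks of higher priority than `k` with the largest
values of `γ U D`; if there are fewer than `⌈μ⌉ - 1` tasks with `U > ρ` (those with `γ ≠ 0`), then
`S` consists of all of these.  Ties are broken arbitrarily. -/
structure IsCarryApprox {N : ℕ} (M : ℕ) (τ : Fin N → SporadicTask) (k : Fin N) (ρ : ℝ)
    (S : Finset (Fin N)) : Prop where
  subset : ∀ i ∈ S, i < k ∧ ρ < (τ i).U
  card_eq : S.card = min (⌈muVal M ρ⌉₊ - 1) {i : Fin N | i < k ∧ ρ < (τ i).U}.ncard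
  largest : ∀ i ∈ S, ∀ j < k, j ∉ S →
    gammaVal (τ j) ρ * (τ j).U * (τ j).D ≤ gammaVal (τ i) ρ * (τ i).U * (τ i).D

end

/-! Suppose a job `j` of task `k` misses its deadline `b`. Go back to the job `p` that starts the
busy period, arriving at `ta`, and put `ℓ = j - p + 1`; then `b - ta` is at least `D'`. Task `k`
runs for `x < ℓ C ≤ ρ (b - ta)` in `[ta, b)`, and whenever it waits, `M` tasks of higher priority
run. Hence their work plus `x` is at least `M (b - ta) - (M - 1) x ≥ μ (b - ta)`.

Extend the window to the left as far as this inequality survives, to `[s, b)`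
(`exists_window_start`). Maximality forces the load on every interval ending at `s` below `μ`, with
two consequences. Fewer than `μ` tasks carry work into the window (`card_carryIn_lt`). A carry-in
task with `U ≤ ρ`, busy since some `φ < s`, has run for more than `ρ (s - φ) ≥ U (s - φ)` before
`s`, so its carry-in costs nothing extra (`volume_real_taskExec_le_of_busyFrom`). Only the other
carry-in tasks cost an extra `U D`, because they meet their deadlines. Summing gives an upper bound
on the work in `[s, b)` which, with `x < ℓ C` and `b - s ≥ D'`, contradicts the test. -/

/-! ### Lengths of sets in windows, and counting -/

/-- The length of the part of `E` before `b` grows at most as fast as time. -/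
theorem continuous_volume_real_inter_Ico_right (E : Set ℝ) (a : ℝ) :
    Continuous fun b => volume.real (E ∩ Set.Ico a b) := by
  refine (LipschitzWith.of_le_add (f := fun b => volume.real (E ∩ Set.Ico a b))
    fun s t => ?_).continuous
  have hsub : E ∩ Set.Ico a s ⊆ (E ∩ Set.Ico a t) ∪ Set.Ico t s := by
    rintro u ⟨hu, hau, hus⟩
    by_cases h : u < t
    · exact Or.inl ⟨hu, hau, h⟩
    · exact Or.inr ⟨not_lt.1 h, hus⟩
  have hfin : volume ((E ∩ Set.Ico a t) ∪ Set.Ico t s) ≠ ⊤ :=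
    (measure_union_lt_top ((measure_mono Set.inter_subset_right).trans_lt
      measure_Ico_lt_top) measure_Ico_lt_top).ne
  have h1 := (measureReal_mono hsub hfin).trans (measureReal_union_le _ _)
  rw [Real.volume_real_Ico] at h1
  have h2 : max (s - t) 0 ≤ dist s t := by
    rw [Real.dist_eq]; exact max_le (le_abs_self _) (abs_nonneg _)
  linarith

/-- The length of the part of `E` from `a` on decreases at most as fast as time. -/
theorem continuous_volume_real_inter_Ico_left (E : Set ℝ) (b : ℝ) :
    Continuous fun a => volume.real (E ∩ Set.Ico a b) := by
  refine (LipschitzWith.of_le_add (f := fun a => volume.real (E ∩ Set.Ico a b))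
    fun s t => ?_).continuous
  have hsub : E ∩ Set.Ico s b ⊆ (E ∩ Set.Ico t b) ∪ Set.Ico s t := by
    rintro u ⟨hu, hau, hus⟩
    by_cases h : u < t
    · exact Or.inr ⟨hau, h⟩
    · exact Or.inl ⟨hu, not_lt.1 h, hus⟩
  have hfin : volume ((E ∩ Set.Ico t b) ∪ Set.Ico s t) ≠ ⊤ :=
    (measure_union_lt_top ((measure_mono Set.inter_subset_right).trans_lt
      measure_Ico_lt_top) measure_Ico_lt_top).ne
  have h1 := (measureReal_mono hsub hfin).trans (measureReal_union_le _ _)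
  rw [Real.volume_real_Ico] at h1
  have h2 : max (t - s) 0 ≤ dist s t := by
    rw [Real.dist_eq, abs_sub_comm]; exact max_le (le_abs_self _) (abs_nonneg _)
  linarith

theorem volume_inter_Ico_ne_top (E : Set ℝ) (a b : ℝ) : volume (E ∩ Set.Ico a b) ≠ ⊤ :=
  ((measure_mono Set.inter_subset_right).trans_lt measure_Ico_lt_top).ne

theorem volume_real_inter_Ico_add {E : Set ℝ} (hE : MeasurableSet E) {a b c : ℝ} (hab : a ≤ b)
    (hbc : b ≤ c) : volume.real (E ∩ Set.Ico a b) + volume.real (E ∩ Set.Ico b c) =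
      volume.real (E ∩ Set.Ico a c) := by
  rw [← Set.Ico_union_Ico_eq_Ico hab hbc, Set.inter_union_distrib_left,
    measureReal_union (Set.Ico_disjoint_Ico_same.mono Set.inter_subset_right
      Set.inter_subset_right) (hE.inter measurableSet_Ico) (volume_inter_Ico_ne_top _ _ _)
      (volume_inter_Ico_ne_top _ _ _)]

open Classical in
/-- If every point of `B` lies in at least `c` of the sets `E i`, `i ∈ A`, then the total length of
these sets in `B` is at least `c` times the length of `B`. -/
theorem mul_volume_real_le_sum {ι : Type*} (A : Finset ι) (E : ι → Set ℝ)
    (hE : ∀ i, MeasurableSet (E i)) {B : Set ℝ} (hB : MeasurableSet B) (hfin : volume B ≠ ⊤)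
    (c : ℝ) (h : ∀ s ∈ B, c ≤ ((A.filter fun i => s ∈ E i).card : ℝ)) :
    c * volume.real B ≤ ∑ i ∈ A, volume.real (E i ∩ B) := by
  have hint : ∀ i ∈ A, IntegrableOn ((E i).indicator fun _ => (1 : ℝ)) B volume := fun i _ =>
    (integrableOn_const (C := (1 : ℝ)) hfin).indicator (hE i)
  have h1 : ∀ i, volume.real (E i ∩ B) = ∫ s in B, (E i).indicator (fun _ => (1 : ℝ)) s := by
    intro i
    rw [integral_indicator (hE i), Measure.restrict_restrict (hE i), setIntegral_const]
    simp
  have h2 : c * volume.real B = ∫ _ in B, c := by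
    rw [setIntegral_const, smul_eq_mul, mul_comm]
  rw [h2, Finset.sum_congr rfl fun i _ => h1 i, ← integral_finsetSum A hint]
  refine setIntegral_mono_on (integrableOn_const hfin) (integrable_finsetSum A hint) hB ?_
  intro s hs
  refine (h s hs).trans (le_of_eq ?_)
  rw [Finset.card_filter]
  push_cast
  exact Finset.sum_congr rfl fun i _ => by simp [Set.indicator_apply]

/-- If `S` consists of elements with the largest values of `g`, then no set with at most as many
elements has a larger sum. -/
theorem sum_le_sum_of_largest {ι : Type*} [DecidableEq ι] (g : ι → ℝ) (S C : Finset ι)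
    (hcard : C.card ≤ S.card) (hg : ∀ i ∈ S, 0 ≤ g i)
    (h : ∀ i ∈ S, ∀ j ∈ C, j ∉ S → g j ≤ g i) : ∑ i ∈ C, g i ≤ ∑ i ∈ S, g i := by
  have hc : (C \ S).card ≤ (S \ C).card := Finset.card_sdiff_le_card_sdiff_iff.2 hcard
  have key : ∑ i ∈ C \ S, g i ≤ ∑ i ∈ S \ C, g i := by
    rcases (S \ C).eq_empty_or_nonempty with h0 | hne
    · rw [h0, Finset.card_empty, Nat.le_zero, Finset.card_eq_zero] at hc
      rw [h0, hc]
    -- The least value on `S \ C` separates the two differences: it dominates every value on `C \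
    -- S`.
    · obtain ⟨m, hm, hmin⟩ := Finset.exists_min_image (S \ C) g hne
      have hmS := (Finset.mem_sdiff.1 hm).1
      calc ∑ i ∈ C \ S, g i ≤ (C \ S).card • g m :=
            Finset.sum_le_card_nsmul _ _ _ fun j hj =>
              h m hmS j (Finset.mem_sdiff.1 hj).1 (Finset.mem_sdiff.1 hj).2
        _ ≤ (S \ C).card • g m := nsmul_le_nsmul_left (hg m hmS) hc
        _ ≤ ∑ i ∈ S \ C, g i := Finset.card_nsmul_le_sum _ _ _ hmin
  have e1 := Finset.sum_inter_add_sum_sdiff C S g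
  have e2 := Finset.sum_inter_add_sum_sdiff S C g
  rw [Finset.inter_comm] at e2
  linarith

theorem muVal_le {M : ℕ} (hM : 2 ≤ M) {ρ : ℝ} (hρ : 0 ≤ ρ) : muVal M ρ ≤ M := by
  have hM' : (2 : ℝ) ≤ M := by exact_mod_cast hM
  unfold muVal
  nlinarith

theorem one_le_muVal {M : ℕ} (hM : 2 ≤ M) {ρ : ℝ} (hρ : ρ ≤ 1) : 1 ≤ muVal M ρ := by
  have hM' : (2 : ℝ) ≤ M := by exact_mod_cast hM
  unfold muVal
  nlinarith

/-! ### Arrivals, service and busy periods -/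

namespace JobSequence

variable {N : ℕ} {τ : Fin N → SporadicTask} {J : JobSequence τ} {M : ℕ}
  {exec : Fin N → ℕ → Set ℝ}

theorem arr_add_mul_le (J : JobSequence τ) (i : Fin N) (j n : ℕ) :
    J.arr i j + n * (τ i).T ≤ J.arr i (j + n) := by
  induction n with
  | zero => simp
  | succ n ih =>
    have := J.arr_sep i (j + n)
    push_cast
    rw [← add_assoc]
    linarith

theorem arr_strictMono (J : JobSequence τ) (i : Fin N) : StrictMono (J.arr i) :=
  strictMono_nat_of_lt_succ fun j => by linarith [J.arr_sep i j, (τ i).T_pos]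

theorem exists_le_arr (J : JobSequence τ) (i : Fin N) (t : ℝ) : ∃ j, t ≤ J.arr i j := by
  obtain ⟨n, hn⟩ := exists_nat_ge (t / (τ i).T)
  refine ⟨n, ?_⟩
  have h1 := J.arr_add_mul_le i 0 n
  have h2 := J.arr_nonneg i 0
  rw [div_le_iff₀ (τ i).T_pos] at hn
  rw [zero_add] at h1
  linarith

theorem service_mono (exec : Fin N → ℕ → Set ℝ) (i : Fin N) (j : ℕ) :
    Monotone (service exec i j) := fun _ _ h =>
  measureReal_mono (Set.inter_subset_inter_right _ (Set.Ico_subset_Ico_right h))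
    (volume_inter_Ico_ne_top _ _ _)

theorem continuous_service (exec : Fin N → ℕ → Set ℝ) (i : Fin N) (j : ℕ) :
    Continuous (service exec i j) :=
  continuous_volume_real_inter_Ico_right (exec i j) 0

/-- The time instants at which task `i` is executed. -/
def taskExec (exec : Fin N → ℕ → Set ℝ) (i : Fin N) : Set ℝ := ⋃ j, exec i j

/-- Job `p` starts a busy period of task `i` that lasts until `t`. -/
structure BusyFrom (J : JobSequence τ) (exec : Fin N → ℕ → Set ℝ) (i : Fin N) (p : ℕ) (t : ℝ) :
    Prop where
  active : ∀ s, J.arr i p ≤ s → s < t → J.Active exec i s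
  finished : ∀ j < p, J.cost i j ≤ service exec i j (J.arr i p)

/-- Take the least `p` from whose arrival the task stays active until `t`. An earlier job still
unfinished at that arrival would be a smaller choice. -/
theorem exists_busyFrom {i : Fin N} {j : ℕ} {t : ℝ}
    (ht : service exec i j t < J.cost i j) : ∃ p ≤ j, BusyFrom J exec i p t := by
  classical
  have hex : ∃ p, ∀ s, J.arr i p ≤ s → s < t → J.Active exec i s :=
    ⟨j, fun s hs hst => ⟨j, hs, (service_mono exec i j hst.le).trans_lt ht⟩⟩
  refine ⟨Nat.find hex, Nat.find_min' hex fun s hs hst =>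
    ⟨j, hs, (service_mono exec i j hst.le).trans_lt ht⟩, Nat.find_spec hex, ?_⟩
  intro q hq
  by_contra hlt
  refine Nat.find_min hex hq fun s hs hst => ?_
  rcases le_or_gt (J.arr i (Nat.find hex)) s with h | h
  · exact Nat.find_spec hex s h hst
  · exact ⟨q, hs, (service_mono exec i q h.le).trans_lt (not_le.1 hlt)⟩

/-! ### Consequences of the scheduling rule -/

namespace IsGlobalFPSchedule

variable (H : J.IsGlobalFPSchedule M exec)
include H

theorem measurableSet_taskExec (i : Fin N) : MeasurableSet (taskExec exec i) :=
  MeasurableSet.iUnion fun j => H.measurable i j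

theorem arr_le {i : Fin N} {j : ℕ} {t : ℝ} (ht : t ∈ exec i j) : J.arr i j ≤ t :=
  ((H.exec_iff i j t).1 ht).1.1

theorem service_lt {i : Fin N} {j : ℕ} {t : ℝ} (ht : t ∈ exec i j) :
    service exec i j t < J.cost i j :=
  ((H.exec_iff i j t).1 ht).1.2

theorem lt_of_finished {i : Fin N} {j : ℕ} {s t : ℝ} (hs : J.cost i j ≤ service exec i j s)
    (ht : t ∈ exec i j) : t < s := by
  by_contra h
  exact absurd (H.service_lt ht) (not_lt.2 (hs.trans (service_mono exec i j (not_lt.1 h))))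

/-- Service is continuous, so exceeding the cost means passing a time at which it equals the cost;
the job is never executed after that. -/
theorem service_le_cost (i : Fin N) (j : ℕ) (t : ℝ) : service exec i j t ≤ J.cost i j := by
  by_contra! hlt
  have h0 : service exec i j (min t 0) ≤ J.cost i j := by
    simp [service, J.cost_nonneg]
  obtain ⟨s, hs, hseq⟩ := intermediate_value_Icc (min_le_left t 0)
    (continuous_service exec i j).continuousOn (show J.cost i j ∈ Set.Icc _ _ from ⟨h0, hlt.le⟩)
  have : service exec i j t ≤ service exec i j s :=
    measureReal_mono (fun u hu => ⟨hu.1, hu.2.1, H.lt_of_finished hseq.ge hu.1⟩)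
      (volume_inter_Ico_ne_top _ _ _)
  linarith

theorem volume_real_exec_le {i : Fin N} {j : ℕ} {B : Set ℝ} {t : ℝ} (hB : ∀ u ∈ B, u < t) :
    volume.real (exec i j ∩ B) ≤ J.cost i j := by
  refine le_trans (measureReal_mono ?_ (volume_inter_Ico_ne_top _ 0 t)) (H.service_le_cost i j t)
  exact fun u hu => ⟨hu.1, (J.arr_nonneg i j).trans (H.arr_le hu.1), hB u hu.2⟩

theorem mem_taskExec {i : Fin N} {t : ℝ} (ha : J.Active exec i t)
    (hc : {i' : Fin N | i' < i ∧ J.Active exec i' t}.ncard < M) : t ∈ taskExec exec i := by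
  classical
  have ha' : ∃ j, J.Pending exec i j t := ha
  exact Set.mem_iUnion.2 ⟨Nat.find ha', (H.exec_iff i _ t).2
    ⟨Nat.find_spec ha', fun j' hj' => Nat.find_min ha' hj', hc⟩⟩

open Classical in
/-- If task `i` has to wait at `t`, then `M` tasks of higher priority are executed. -/
theorem le_card_of_le_ncard {i k : Fin N} (hik : i ≤ k) {t : ℝ}
    (hc : M ≤ {i' : Fin N | i' < i ∧ J.Active exec i' t}.ncard) :
    M ≤ ((Finset.Iio k).filter fun i' => t ∈ taskExec exec i').card := by
  induction i using WellFoundedLT.induction with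
  | ind i ih =>
    -- An active task need not be running. Descend to a task none of whose predecessors is blocked:
    -- then all active tasks above it do run.
    by_cases h : ∃ a < i, M ≤ {i' : Fin N | i' < a ∧ J.Active exec i' t}.ncard
    · obtain ⟨a, ha, hM⟩ := h
      exact ih a ha (ha.le.trans hik) hM
    · push Not at h
      rw [← Set.ncard_coe_finset]
      refine hc.trans (Set.ncard_le_ncard ?_ (Set.toFinite _))
      rintro a ⟨hai, hact⟩
      simp only [Finset.coe_filter, Finset.mem_Iio, Set.mem_ofPred_eq]
      exact ⟨hai.trans_le hik, H.mem_taskExec hact (h a hai)⟩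

open Classical in
theorem le_card_of_active {i k : Fin N} (hik : i ≤ k) {t : ℝ} (ha : J.Active exec i t)
    (ht : t ∉ taskExec exec i) :
    M ≤ ((Finset.Iio k).filter fun i' => t ∈ taskExec exec i').card :=
  H.le_card_of_le_ncard hik (not_lt.1 fun h => ht (H.mem_taskExec ha h))

/-! ### Workload of a single task -/

/-- The jobs of task `i` that arrive at or after `a` are executed for at most
`U (b - a) + C - C U` time units before `b`. -/
theorem workload_le {i : Fin N} {p : ℕ} {a b : ℝ} (hp : a ≤ J.arr i p) (hab : a ≤ b) :
    volume.real ((⋃ j ≥ p, exec i j) ∩ Set.Iio b) ≤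
      (τ i).U * (b - a) + ((τ i).C - (τ i).C * (τ i).U) := by
  have hT := (τ i).T_pos
  have hUT : (τ i).U * (τ i).T = (τ i).C := div_mul_cancel₀ _ hT.ne'
  have hU1 : (τ i).U ≤ 1 := (τ i).C_le_T
  have hU0 : 0 ≤ (τ i).U := (div_pos (τ i).C_pos hT).le
  -- Peel off one period at a time: a job costs at most `C = U T`. In a last window of length `L <
  -- T` the work is at most `min C L`, hence at most the convex combination `U L + (1 - U) C`.
  have main : ∀ n : ℕ, ∀ p a, a ≤ J.arr i p → a ≤ b → b - a < n * (τ i).T →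
      volume.real ((⋃ j ≥ p, exec i j) ∩ Set.Iio b) ≤
        (τ i).U * (b - a) + ((τ i).C - (τ i).C * (τ i).U) := by
    intro n
    induction n with
    | zero => intro p a _ hab h; simp at h; linarith
    | succ n ih =>
      intro p a hp hab hn
      rcases lt_or_ge (b - a) (τ i).T with hlt | hge
      · have hsub : (⋃ j ≥ p, exec i j) ∩ Set.Iio b ⊆ exec i p ∩ Set.Ico a b := by
          rintro u ⟨hu, hub⟩
          simp only [Set.mem_iUnion] at hu
          obtain ⟨j, hj, hu⟩ := hu
          have harr := H.arr_le hu
          rcases hj.lt_or_eq with h | rfl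
          · have h1 := (J.arr_strictMono i).monotone (Nat.succ_le_of_lt h)
            have h2 := J.arr_sep i p
            have h3 : u < b := hub
            simp only [Nat.succ_eq_add_one] at h1
            linarith
          · exact ⟨hu, hp.trans harr, hub⟩
        have h1 := measureReal_mono hsub (volume_inter_Ico_ne_top _ _ _)
        have h2 : volume.real (exec i p ∩ Set.Ico a b) ≤ (τ i).C :=
          (H.volume_real_exec_le fun u hu => hu.2).trans (J.cost_le i p)
        have h3 : volume.real (exec i p ∩ Set.Ico a b) ≤ b - a := by
          refine (measureReal_mono Set.inter_subset_right measure_Ico_lt_top.ne).trans ?_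
          rw [Real.volume_real_Ico, max_eq_left (by linarith)]
        nlinarith
      · have hsub : (⋃ j ≥ p, exec i j) ∩ Set.Iio b ⊆
            (exec i p ∩ Set.Ico a b) ∪ ((⋃ j ≥ p + 1, exec i j) ∩ Set.Iio b) := by
          rintro u ⟨hu, hub⟩
          simp only [Set.mem_iUnion] at hu
          obtain ⟨j, hj, hu⟩ := hu
          rcases hj.lt_or_eq with h | rfl
          · refine Or.inr ⟨?_, hub⟩
            simp only [Set.mem_iUnion]
            exact ⟨j, h, hu⟩
          · exact Or.inl ⟨hu, hp.trans (H.arr_le hu), hub⟩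
        have hfin : volume ((⋃ j ≥ p + 1, exec i j) ∩ Set.Iio b) ≠ ⊤ := by
          refine ((measure_mono ?_).trans_lt (measure_Ico_lt_top (a := (0 : ℝ)) (b := b))).ne
          rintro u ⟨hu, hub⟩
          simp only [Set.mem_iUnion] at hu
          obtain ⟨j, hj, hu⟩ := hu
          exact ⟨(J.arr_nonneg i j).trans (H.arr_le hu), hub⟩
        have h1 := (measureReal_mono hsub (measure_union_ne_top
          (volume_inter_Ico_ne_top _ _ _) hfin)).trans (measureReal_union_le _ _)
        have h2 : volume.real (exec i p ∩ Set.Ico a b) ≤ (τ i).C :=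
          (H.volume_real_exec_le fun u hu => hu.2).trans (J.cost_le i p)
        have h3 := ih (p + 1) (a + (τ i).T) (by linarith [J.arr_sep i p]) (by linarith)
          (by push_cast at hn; linarith)
        nlinarith
  obtain ⟨n, hn⟩ := exists_nat_gt ((b - a) / (τ i).T)
  exact main n p a hp hab ((div_lt_iff₀ hT).1 hn)

/-- `workload_le` for a window `[s, b)` at whose start all jobs before job `p` are finished. -/
theorem volume_real_taskExec_le {i : Fin N} {p : ℕ} {a b s : ℝ} (hp : a ≤ J.arr i p)
    (hab : a ≤ b) (hfin : ∀ j < p, J.cost i j ≤ service exec i j s) :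
    volume.real (taskExec exec i ∩ Set.Ico s b) ≤
      (τ i).U * (b - a) + ((τ i).C - (τ i).C * (τ i).U) := by
  refine le_trans (measureReal_mono ?_ ?_) (H.workload_le hp hab)
  · rintro u ⟨hu, hsu, hub⟩
    obtain ⟨j, hj⟩ := Set.mem_iUnion.1 hu
    refine ⟨?_, hub⟩
    simp only [Set.mem_iUnion]
    refine ⟨j, not_lt.1 fun h => ?_, hj⟩
    exact absurd (H.lt_of_finished (hfin j h) hj) (not_lt.2 hsu)
  · refine ((measure_mono ?_).trans_lt (measure_Ico_lt_top (a := (0 : ℝ)) (b := b))).ne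
    rintro u ⟨hu, hub⟩
    simp only [Set.mem_iUnion] at hu
    obtain ⟨j, hj, hu⟩ := hu
    exact ⟨(J.arr_nonneg i j).trans (H.arr_le hu), hub⟩

/-- The work in `[s, b)` of a task whose jobs from before `s` are all finished at `s`. -/
theorem volume_real_taskExec_le_of_no_carryIn {i : Fin N} {s b : ℝ} (hsb : s ≤ b)
    (h : ∀ j, J.arr i j < s → J.cost i j ≤ service exec i j s) :
    volume.real (taskExec exec i ∩ Set.Ico s b) ≤
      (τ i).U * (b - s) + ((τ i).C - (τ i).C * (τ i).U) := by
  classical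
  have hex := J.exists_le_arr i s
  exact H.volume_real_taskExec_le (Nat.find_spec hex) hsb fun j hj =>
    h j (not_le.1 (Nat.find_min hex hj))

/-- The work in `[s, b)` of a schedulable task with an unfinished job at `s`. -/
theorem volume_real_taskExec_le_of_deadline {i : Fin N} {s b : ℝ} (hsb : s ≤ b)
    (hdl : ∀ j, J.MeetsDeadline exec i j)
    (h : ∃ j, J.arr i j < s ∧ service exec i j s < J.cost i j) :
    volume.real (taskExec exec i ∩ Set.Ico s b) ≤
      (τ i).U * (b - s) + ((τ i).C - (τ i).C * (τ i).U) + (τ i).U * (τ i).D := by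
  classical
  have hU0 : 0 ≤ (τ i).U := (div_pos (τ i).C_pos (τ i).T_pos).le
  obtain ⟨harr, hser⟩ := Nat.find_spec h
  -- The earliest unfinished job meets its deadline, so it arrived after `s - D`; counting from its
  -- arrival costs at most `U D` more.
  have hD : s < J.arr i (Nat.find h) + (τ i).D := by
    by_contra hle
    have := service_mono exec i (Nat.find h) (not_lt.1 hle)
    have h2 := hdl (Nat.find h)
    unfold MeetsDeadline at h2
    linarith
  have key := H.volume_real_taskExec_le (s := s) le_rfl (harr.le.trans hsb) fun j hj => by
    by_contra hlt
    exact Nat.find_min h hj ⟨((J.arr_strictMono i) hj).trans harr, not_le.1 hlt⟩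
  have : (τ i).U * (b - J.arr i (Nat.find h)) ≤ (τ i).U * (b - s + (τ i).D) :=
    mul_le_mul_of_nonneg_left (by linarith) hU0
  linarith

/-- If a task with utilization at most `ρ` is busy from the arrival of job `p` to `s`, and the
tasks of higher priority than `k` load the system by less than `M - (M - 1) ρ` in that time, then
the task has no more work in `[s, b)` than if it had none left at `s`. -/
theorem volume_real_taskExec_le_of_busyFrom {i k : Fin N} (hik : i < k) (hM : 2 ≤ M) {p : ℕ}
    {s b ρ : ℝ} (hps : J.arr i p < s) (hsb : s ≤ b) (hbusy : BusyFrom J exec i p s)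
    (hU : (τ i).U ≤ ρ)
    (hload : ∑ a ∈ Finset.Iio k, volume.real (taskExec exec a ∩ Set.Ico (J.arr i p) s) <
      muVal M ρ * (s - J.arr i p)) :
    volume.real (taskExec exec i ∩ Set.Ico s b) ≤
      (τ i).U * (b - s) + ((τ i).C - (τ i).C * (τ i).U) := by
  classical
  set φ := J.arr i p with hφ
  have hmeas := fun a => H.measurableSet_taskExec a
  have h1 := mul_volume_real_le_sum (Finset.Iio k) (taskExec exec) hmeas
    (B := Set.Ico φ s \ taskExec exec i) (measurableSet_Ico.diff (hmeas i))
    ((measure_mono Set.sdiff_subset).trans_lt measure_Ico_lt_top).ne M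
    (fun u hu => by
      exact_mod_cast H.le_card_of_active hik.le (hbusy.active u hu.1.1 hu.1.2) hu.2)
  have h2 := mul_volume_real_le_sum (Finset.Iio k) (taskExec exec) hmeas
    (B := Set.Ico φ s ∩ taskExec exec i) (measurableSet_Ico.inter (hmeas i))
    ((measure_mono Set.inter_subset_left).trans_lt measure_Ico_lt_top).ne 1
    (fun u hu => by
      have : 0 < ((Finset.Iio k).filter fun a => u ∈ taskExec exec a).card :=
        Finset.card_pos.2 ⟨i, by simp [hik, hu.2]⟩
      exact_mod_cast this)
  have h3 : ∑ a ∈ Finset.Iio k, volume.real (taskExec exec a ∩ Set.Ico φ s) =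
      ∑ a ∈ Finset.Iio k, volume.real (taskExec exec a ∩ (Set.Ico φ s ∩ taskExec exec i)) +
      ∑ a ∈ Finset.Iio k, volume.real (taskExec exec a ∩ (Set.Ico φ s \ taskExec exec i)) := by
    rw [← Finset.sum_add_distrib]
    refine Finset.sum_congr rfl fun a _ => ?_
    rw [← Set.inter_assoc, ← Set.inter_sdiff_assoc,
      measureReal_inter_add_sdiff (hmeas i) (volume_inter_Ico_ne_top _ _ _)]
  have h4 := measureReal_inter_add_sdiff (μ := volume) (s := Set.Ico φ s) (hmeas i)
    measure_Ico_lt_top.ne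
  rw [Real.volume_real_Ico, max_eq_left (by linarith)] at h4
  have h5 := H.volume_real_taskExec_le (b := b) (s := φ) hφ.le (hps.le.trans hsb) hbusy.finished
  have h6 := volume_real_inter_Ico_add (hmeas i) hps.le hsb
  rw [Set.inter_comm (taskExec exec i) (Set.Ico φ s)] at h6
  have hM' : (2 : ℝ) ≤ M := by exact_mod_cast hM
  set y := volume.real (Set.Ico φ s ∩ taskExec exec i)
  -- The load is at least `M` while the task waits and `1` while it runs, so `M (s - φ - y) + y < μ
  -- (s - φ)`.
  have hy : ρ * (s - φ) < y := by
    unfold muVal at hload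
    have : ((M : ℝ) - 1) * (ρ * (s - φ)) < ((M : ℝ) - 1) * y := by nlinarith
    exact lt_of_mul_lt_mul_left this (by linarith)
  have hUρ : (τ i).U * (s - φ) ≤ ρ * (s - φ) := mul_le_mul_of_nonneg_right hU (by linarith)
  linarith

/-- In a busy period that job `p` starts and in which job `j ≥ p` is unfinished, task `k` is
executed for less than `(j - p + 1) C` time units. -/
theorem volume_real_taskExec_lt {k : Fin N} {p j : ℕ} (hpj : p ≤ j) {t : ℝ}
    (hfin : ∀ q < p, J.cost k q ≤ service exec k q (J.arr k p))
    (hj : service exec k j t < J.cost k j) :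
    volume.real (taskExec exec k ∩ Set.Ico (J.arr k p) t) < ((j - p + 1 : ℕ) : ℝ) * (τ k).C := by
  have hsub : taskExec exec k ∩ Set.Ico (J.arr k p) t ⊆
      ⋃ q ∈ Finset.Icc p j, exec k q ∩ Set.Ico 0 t := by
    rintro u ⟨hu, hpu, hut⟩
    obtain ⟨q, hq⟩ := Set.mem_iUnion.1 hu
    have hpq : p ≤ q := not_lt.1 fun h =>
      absurd (H.lt_of_finished (hfin q h) hq) (not_lt.2 hpu)
    -- Jobs of a task run in order, so none after `j` starts while `j` is unfinished.
    have hqj : q ≤ j := by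
      by_contra! h
      refine ((H.exec_iff k q u).1 hq).2.1 j h
        ⟨(J.arr_strictMono k h).le.trans (H.arr_le hq), ?_⟩
      exact (service_mono exec k j hut.le).trans_lt hj
    simp only [Set.mem_iUnion]
    exact ⟨q, Finset.mem_Icc.2 ⟨hpq, hqj⟩, hq, (J.arr_nonneg k p).trans hpu, hut⟩
  have hne : volume (⋃ q ∈ Finset.Icc p j, exec k q ∩ Set.Ico 0 t) ≠ ⊤ := by
    refine ((measure_mono ?_).trans_lt (measure_Ico_lt_top (a := (0 : ℝ)) (b := t))).ne
    exact Set.iUnion₂_subset fun q _ => Set.inter_subset_right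
  calc _ ≤ volume.real (⋃ q ∈ Finset.Icc p j, exec k q ∩ Set.Ico 0 t) := measureReal_mono hsub hne
    _ ≤ ∑ q ∈ Finset.Icc p j, service exec k q t := measureReal_biUnion_finset_le _ _
    _ < ∑ q ∈ Finset.Icc p j, (τ k).C := by
      refine Finset.sum_lt_sum (fun q _ => (H.service_le_cost k q t).trans (J.cost_le k q))
        ⟨j, Finset.mem_Icc.2 ⟨hpj, le_rfl⟩, hj.trans_le (J.cost_le k j)⟩
    _ = _ := by
      rw [Finset.sum_const, Nat.card_Icc, nsmul_eq_mul, Nat.sub_add_comm hpj]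

/-! ### Extending the window and bounding carry-in -/

/-- If the tasks of higher priority than `k` load `[ta, b)`, apart from `x` time units, by at least
`muVal M ρ`, then the window can be extended to the left to some `[s, b)` that is loaded as much
and before which the load stays below `muVal M ρ`. -/
theorem exists_window_start (hM : 2 ≤ M) {k : Fin N} {ta b x ρ : ℝ} (htab : ta ≤ b)
    (hρ1 : ρ ≤ 1)
    (hta : muVal M ρ * (b - ta) ≤
      ∑ i ∈ Finset.Iio k, volume.real (taskExec exec i ∩ Set.Ico ta b) + x) :
    ∃ s ≤ ta, muVal M ρ * (b - s) ≤
        ∑ i ∈ Finset.Iio k, volume.real (taskExec exec i ∩ Set.Ico s b) + x ∧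
      ∀ t < s, ∑ i ∈ Finset.Iio k, volume.real (taskExec exec i ∩ Set.Ico t s) <
        muVal M ρ * (s - t) := by
  set W : ℝ → ℝ := fun t => ∑ i ∈ Finset.Iio k, volume.real (taskExec exec i ∩ Set.Ico t b)
    with hW
  have hWc : Continuous W :=
    continuous_finsetSum _ fun i _ => continuous_volume_real_inter_Ico_left (taskExec exec i) b
  set K : Set ℝ := {t | t ≤ ta ∧ muVal M ρ * (b - t) ≤ W t + x} with hK
  have hKc : IsClosed K := (isClosed_le continuous_id continuous_const).inter
    (isClosed_le (f := fun t => muVal M ρ * (b - t)) (by fun_prop) (hWc.add continuous_const))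
  -- Nothing runs before time `0`, so `W` stops growing there while the left side grows at rate `μ ≥
  -- 1`. With closedness this makes the infimum a valid window start.
  have hKb : BddBelow K := by
    refine ⟨min 0 (b - (W 0 + x)), ?_⟩
    rintro t ⟨ht, hload⟩
    rcases le_or_gt 0 t with h0 | h0
    · exact (min_le_left _ _).trans h0
    · refine (min_le_right _ _).trans ?_
      have hW0 : W t ≤ W 0 := by
        refine Finset.sum_le_sum fun i _ => measureReal_mono ?_ (volume_inter_Ico_ne_top _ _ _)
        rintro u ⟨hu, _, hub⟩
        obtain ⟨j, hj⟩ := Set.mem_iUnion.1 hu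
        exact ⟨hu, (J.arr_nonneg i j).trans (H.arr_le hj), hub⟩
      have := one_le_muVal hM hρ1
      nlinarith
  obtain ⟨hs1, hs2⟩ : sInf K ∈ K := hKc.csInf_mem ⟨ta, le_rfl, hta⟩ hKb
  refine ⟨sInf K, hs1, hs2, fun t ht => ?_⟩
  have hnot : t ∉ K := fun h => absurd (csInf_le hKb h) (not_le.2 ht)
  have hlt : W t + x < muVal M ρ * (b - t) := by
    by_contra h
    exact hnot ⟨ht.le.trans hs1, not_lt.1 h⟩
  have hadd : ∑ i ∈ Finset.Iio k, volume.real (taskExec exec i ∩ Set.Ico t (sInf K)) +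
      W (sInf K) = W t := by
    rw [hW, ← Finset.sum_add_distrib]
    exact Finset.sum_congr rfl fun i _ =>
      volume_real_inter_Ico_add (H.measurableSet_taskExec i) ht.le (hs1.trans htab)
  linarith

open Classical in
/-- If the load by the tasks of higher priority than `k` stays below `μ` before `s`, then fewer
than `μ` of these tasks have unfinished jobs at `s` that arrived earlier. -/
theorem card_carryIn_lt {k : Fin N} {s μ : ℝ} (hμ : μ ≤ M)
    (h : ∀ t < s, ∑ i ∈ Finset.Iio k, volume.real (taskExec exec i ∩ Set.Ico t s) < μ * (s - t)) :
    (((Finset.Iio k).filter fun i =>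
      ∃ j, J.arr i j < s ∧ service exec i j s < J.cost i j).card : ℝ) < μ := by
  set Q := (Finset.Iio k).filter fun i => ∃ j, J.arr i j < s ∧ service exec i j s < J.cost i j
    with hQ
  have hmem : ∀ i ∈ Q, ∃ j, J.arr i j < s ∧ service exec i j s < J.cost i j := fun i hi =>
    (Finset.mem_filter.1 hi).2
  choose! f hf using hmem
  -- From the last of these arrivals until `s` every task in `Q` is active. At some instant in
  -- between fewer than `μ ≤ M` tasks run, so none in `Q` waits there and all of `Q` is counted
  -- among the running tasks.
  obtain ⟨t, hts, ht⟩ : ∃ t < s, ∀ i ∈ Q, J.arr i (f i) ≤ t := by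
    rcases Q.eq_empty_or_nonempty with h0 | hne
    · exact ⟨s - 1, by linarith, by simp [h0]⟩
    · obtain ⟨m, hm, hmax⟩ := Finset.exists_max_image Q (fun i => J.arr i (f i)) hne
      exact ⟨J.arr m (f m), (hf m hm).1, hmax⟩
  obtain ⟨u, hu, hcount⟩ : ∃ u ∈ Set.Ico t s,
      (((Finset.Iio k).filter fun i => u ∈ taskExec exec i).card : ℝ) < μ := by
    by_contra! hno
    have h1 := mul_volume_real_le_sum (Finset.Iio k) (taskExec exec) H.measurableSet_taskExec
      measurableSet_Ico measure_Ico_lt_top.ne μ hno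
    rw [Real.volume_real_Ico, max_eq_left (by linarith)] at h1
    exact absurd (h t hts) (not_lt.2 h1)
  refine lt_of_le_of_lt ?_ hcount
  have hsub : Q ⊆ (Finset.Iio k).filter fun i => u ∈ taskExec exec i := by
    intro i hi
    have hik := (Finset.mem_filter.1 hi).1
    refine Finset.mem_filter.2 ⟨hik, ?_⟩
    by_contra hn
    have hact : J.Active exec i u := ⟨f i, (ht i hi).trans hu.1,
      (service_mono exec i (f i) hu.2.le).trans_lt (hf i hi).2⟩
    have h2 : (M : ℝ) ≤ _ := Nat.cast_le.2 (H.le_card_of_active (Finset.mem_Iio.1 hik).le hact hn)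
    linarith
  exact_mod_cast Finset.card_le_card hsub

/-- The work in `[s, b)` of the tasks of higher priority than `k`, when the load by these tasks
stays below `muVal M ρ` before `s`. -/
theorem sum_volume_real_taskExec_le (hM : 2 ≤ M) {k : Fin N} {s b ρ : ℝ} (hsb : s ≤ b)
    (hρ : 0 ≤ ρ) (hdl : ∀ i < k, ∀ j, J.MeetsDeadline exec i j)
    (h : ∀ t < s, ∑ i ∈ Finset.Iio k, volume.real (taskExec exec i ∩ Set.Ico t s) <
      muVal M ρ * (s - t))
    {S : Finset (Fin N)} (hS : IsCarryApprox M τ k ρ S) :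
    ∑ i ∈ Finset.Iio k, volume.real (taskExec exec i ∩ Set.Ico s b) ≤
      ∑ i ∈ S, gammaVal (τ i) ρ * (τ i).U * (τ i).D +
        ∑ i ∈ Finset.Iio k, ((τ i).U * (b - s) + ((τ i).C - (τ i).C * (τ i).U)) := by
  classical
  set g : Fin N → ℝ := fun i => gammaVal (τ i) ρ * (τ i).U * (τ i).D with hg
  have hUpos : ∀ i, 0 < (τ i).U := fun i => div_pos (τ i).C_pos (τ i).T_pos
  have hg0 : ∀ i, 0 ≤ g i := fun i => by
    have : 0 ≤ gammaVal (τ i) ρ := by unfold gammaVal; split_ifs <;> norm_num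
    exact mul_nonneg (mul_nonneg this (hUpos i).le) (τ i).D_pos.le
  set Q := (Finset.Iio k).filter fun i => ∃ j, J.arr i j < s ∧ service exec i j s < J.cost i j
    with hQ
  -- The tasks in `R` are the only ones charged `U D`; being fewer than `μ`, they number at most
  -- `⌈μ⌉ - 1`.
  set R := Q.filter fun i => ρ < (τ i).U with hR
  have hRk : R ⊆ Finset.Iio k := (Finset.filter_subset _ _).trans (Finset.filter_subset _ _)
  have hcard : R.card ≤ S.card := by
    rw [hS.card_eq]
    refine le_min ?_ ?_
    · have h1 := H.card_carryIn_lt (muVal_le hM hρ) h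
      have h2 : (R.card : ℝ) ≤ Q.card := by exact_mod_cast Finset.card_filter_le _ _
      have := Nat.lt_ceil.2 (h2.trans_lt h1)
      omega
    · rw [← Set.ncard_coe_finset]
      refine Set.ncard_le_ncard ?_ (Set.toFinite _)
      intro i hi
      exact ⟨Finset.mem_Iio.1 (hRk hi), (Finset.mem_filter.1 hi).2⟩
  have hsum : ∑ i ∈ R, g i ≤ ∑ i ∈ S, g i :=
    sum_le_sum_of_largest g S R hcard (fun i _ => hg0 i) fun i hi j hj hjS =>
      hS.largest i hi j (Finset.mem_Iio.1 (hRk hj)) hjS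
  have hR' : ∑ i ∈ R, g i = ∑ i ∈ Finset.Iio k, if i ∈ R then g i else 0 := by
    rw [← Finset.sum_filter, Finset.filter_mem_eq_inter, Finset.inter_eq_right.2 hRk]
  refine le_trans ?_ (add_le_add_left hsum _)
  rw [hR', ← Finset.sum_add_distrib]
  refine Finset.sum_le_sum fun i hi => ?_
  have hik := Finset.mem_Iio.1 hi
  by_cases hc : ∃ j, J.arr i j < s ∧ service exec i j s < J.cost i j
  · rcases lt_or_ge ρ (τ i).U with hρU | hUρ
    · have hiR : i ∈ R := Finset.mem_filter.2 ⟨Finset.mem_filter.2 ⟨hi, hc⟩, hρU⟩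
      have := H.volume_real_taskExec_le_of_deadline hsb (hdl i hik) hc
      rw [if_pos hiR]
      simp only [hg, gammaVal, if_pos hρU]
      linarith
    · have hiR : i ∉ R := fun hiR => absurd (Finset.mem_filter.1 hiR).2 (not_lt.2 hUρ)
      rw [if_neg hiR, zero_add]
      obtain ⟨j, hj, hser⟩ := hc
      obtain ⟨p, hpj, hbusy⟩ := exists_busyFrom hser
      have hps := ((J.arr_strictMono i).monotone hpj).trans_lt hj
      exact H.volume_real_taskExec_le_of_busyFrom hik hM hps hsb hbusy hUρ (h _ hps)
  · have hiR : i ∉ R := fun hiR =>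
      hc (Finset.mem_filter.1 (Finset.mem_filter.1 hiR).1).2
    rw [if_neg hiR, zero_add]
    push Not at hc
    exact H.volume_real_taskExec_le_of_no_carryIn hsb hc

/-! ### The test in one busy period, and the theorem -/

/-- The schedulability test for job `j` of task `k`, in a busy period of task `k` that job
`p ≤ j` starts. -/
theorem meetsDeadline_of_busyFrom (hM : 2 ≤ M) {k : Fin N}
    (hdl : ∀ i < k, ∀ j, J.MeetsDeadline exec i j) {p j : ℕ} (hpj : p ≤ j)
    (hbusy : BusyFrom J exec k p (J.arr k j + (τ k).D)) {ℓ : ℕ} (hℓ : ℓ = j - p + 1) {ρ : ℝ}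
    (hρ : (ℓ : ℝ) * (τ k).C / dPrime (τ k) ℓ ≤ ρ) (hρ1 : ρ ≤ 1) {S : Finset (Fin N)}
    (hS : IsCarryApprox M τ k ρ S)
    (hcond : (ℓ : ℝ) * (τ k).C / dPrime (τ k) ℓ
        + ∑ i ∈ S, gammaVal (τ i) ρ * (τ i).U * (τ i).D / dPrime (τ k) ℓ
        + ∑ i ∈ Finset.Iio k,
            (((τ i).C - (τ i).C * (τ i).U) / dPrime (τ k) ℓ + (τ i).U) ≤ muVal M ρ) :
    J.MeetsDeadline exec k j := by
  classical
  unfold MeetsDeadline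
  by_contra! hmiss
  set b := J.arr k j + (τ k).D with hb
  set ta := J.arr k p with hta
  set d := dPrime (τ k) ℓ with hd
  have hM' : (2 : ℝ) ≤ M := by exact_mod_cast hM
  have hdpos : 0 < d := by
    have h1 : (1 : ℝ) ≤ ℓ := by exact_mod_cast (by omega : 1 ≤ ℓ)
    have := mul_nonneg (sub_nonneg.2 h1) (τ k).T_pos.le
    have := (τ k).D_pos
    rw [hd, dPrime]; linarith
  have hlen : d ≤ b - ta := by
    have h1 := J.arr_add_mul_le k p (j - p)
    rw [Nat.add_sub_cancel' hpj] at h1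
    rw [hd, dPrime, hℓ]
    push_cast [hb]
    linarith
  have htab : ta ≤ b := by linarith
  set x := volume.real (taskExec exec k ∩ Set.Ico ta b) with hx
  have hxlt : x < ℓ * (τ k).C := hℓ ▸ H.volume_real_taskExec_lt hpj hbusy.finished hmiss
  have hρ0 : 0 ≤ ρ := le_trans (div_nonneg
    (mul_nonneg (Nat.cast_nonneg _) (τ k).C_pos.le) hdpos.le) hρ
  have hxρ : x ≤ ρ * (b - ta) := by
    rw [div_le_iff₀ hdpos] at hρ
    have := mul_le_mul_of_nonneg_left hlen hρ0
    linarith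
  have hmeas := H.measurableSet_taskExec
  have hwork := mul_volume_real_le_sum (Finset.Iio k) (taskExec exec) hmeas
    (B := Set.Ico ta b \ taskExec exec k) (measurableSet_Ico.diff (hmeas k))
    ((measure_mono Set.sdiff_subset).trans_lt measure_Ico_lt_top).ne M
    (fun u hu => by
      exact_mod_cast H.le_card_of_active le_rfl (hbusy.active u hu.1.1 hu.1.2) hu.2)
  have hsplit := measureReal_inter_add_sdiff (μ := volume) (s := Set.Ico ta b) (hmeas k)
    measure_Ico_lt_top.ne
  rw [Real.volume_real_Ico, max_eq_left (by linarith), Set.inter_comm] at hsplit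
  have hle : ∑ i ∈ Finset.Iio k, volume.real (taskExec exec i ∩ (Set.Ico ta b \ taskExec exec k)) ≤
      ∑ i ∈ Finset.Iio k, volume.real (taskExec exec i ∩ Set.Ico ta b) :=
    Finset.sum_le_sum fun i _ => measureReal_mono
      (Set.inter_subset_inter_right _ Set.sdiff_subset) (volume_inter_Ico_ne_top _ _ _)
  have hstart : muVal M ρ * (b - ta) ≤
      ∑ i ∈ Finset.Iio k, volume.real (taskExec exec i ∩ Set.Ico ta b) + x := by
    unfold muVal
    have : ((M : ℝ) - 1) * x ≤ ((M : ℝ) - 1) * (ρ * (b - ta)) :=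
      mul_le_mul_of_nonneg_left hxρ (by linarith)
    have h3 : (M : ℝ) * volume.real (Set.Ico ta b \ taskExec exec k) = M * (b - ta - x) := by
      rw [← hsplit]; ring
    linarith
  obtain ⟨s, hsta, hs, hbefore⟩ := H.exists_window_start hM htab hρ1 hstart
  have hup := H.sum_volume_real_taskExec_le hM (hsta.trans htab) hρ0 hdl hbefore hS
  rw [Finset.sum_add_distrib, ← Finset.sum_mul] at hup
  rw [← Finset.sum_div, Finset.sum_add_distrib, ← Finset.sum_div] at hcond
  set G := ∑ i ∈ S, gammaVal (τ i) ρ * (τ i).U * (τ i).D with hG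
  set A := ∑ i ∈ Finset.Iio k, ((τ i).C - (τ i).C * (τ i).U) with hA
  set V := ∑ i ∈ Finset.Iio k, (τ i).U with hV
  have hG0 : 0 ≤ G := Finset.sum_nonneg fun i _ => by
    have : 0 ≤ gammaVal (τ i) ρ := by unfold gammaVal; split_ifs <;> norm_num
    exact mul_nonneg (mul_nonneg this (div_pos (τ i).C_pos (τ i).T_pos).le) (τ i).D_pos.le
  have hA0 : 0 ≤ A := Finset.sum_nonneg fun i _ => by
    have hU1 : (τ i).U ≤ 1 := (τ i).C_le_T
    have := mul_le_mul_of_nonneg_left hU1 (τ i).C_pos.le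
    linarith
  have hC0 : 0 ≤ (ℓ : ℝ) * (τ k).C := mul_nonneg (Nat.cast_nonneg _) (τ k).C_pos.le
  have hrw : (ℓ : ℝ) * (τ k).C / d + G / d + (A / d + V) =
      (ℓ * (τ k).C + G + A) / d + V := by ring
  rw [hrw] at hcond
  have hdiv : (ℓ * (τ k).C + G + A) / d ≤ muVal M ρ - V := by linarith
  -- This sign allows `d` to be replaced by the longer window length `b - s`.
  have hV0 : 0 ≤ muVal M ρ - V := le_trans (by positivity) hdiv
  rw [div_le_iff₀ hdpos] at hdiv
  have hmono := mul_le_mul_of_nonneg_left (show d ≤ b - s by linarith) hV0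
  linarith

end IsGlobalFPSchedule
end JobSequence

theorem theorem4p4 {N : ℕ} (M : ℕ) (hM : 2 ≤ M) (τ : Fin N → SporadicTask) (k : Fin N)
    (hhp : ∀ i < k, Schedulable M τ i) :
    ((∀ ℓ : ℕ, 1 ≤ ℓ →
        ∃ ρ : ℝ, (ℓ : ℝ) * (τ k).C / dPrime (τ k) ℓ ≤ ρ ∧ ρ ≤ 1 ∧
          ∃ S : Finset (Fin N), IsCarryApprox M τ k ρ S ∧
            (ℓ : ℝ) * (τ k).C / dPrime (τ k) ℓ
              + ∑ i ∈ S, gammaVal (τ i) ρ * (τ i).U * (τ i).D / dPrime (τ k) ℓ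
              + ∑ i ∈ Finset.Iio k,
                  (((τ i).C - (τ i).C * (τ i).U) / dPrime (τ k) ℓ + (τ i).U)
              ≤ muVal M ρ) →
      Schedulable M τ k) ∧
    ((τ k).D ≤ (τ k).T →
      (∃ ρ : ℝ, (τ k).C / (τ k).D ≤ ρ ∧ ρ ≤ 1 ∧
          ∃ S : Finset (Fin N), IsCarryApprox M τ k ρ S ∧
            (τ k).C / (τ k).D
              + ∑ i ∈ S, gammaVal (τ i) ρ * (τ i).U * (τ i).D / (τ k).D
              + ∑ i ∈ Finset.Iio k,
                  (((τ i).C - (τ i).C * (τ i).U) / (τ k).D + (τ i).U)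
              ≤ muVal M ρ) →
      Schedulable M τ k) := by
  constructor
  · intro hcond J exec H j
    by_contra hmiss
    obtain ⟨p, hpj, hbusy⟩ := JobSequence.exists_busyFrom (J := J) (not_le.1 hmiss)
    obtain ⟨ρ, hρ, hρ1, S, hS, hle⟩ := hcond (j - p + 1) (Nat.le_add_left 1 _)
    exact hmiss (H.meetsDeadline_of_busyFrom hM (fun i hi => hhp i hi J exec H) hpj hbusy rfl
      hρ hρ1 hS hle)
  · rintro hDT ⟨ρ, hρ, hρ1, S, hS, hle⟩ J exec H j
    induction j using Nat.strong_induction_on with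
    | _ j ih =>
      by_contra hmiss
      -- As `D ≤ T`, earlier jobs that met their deadlines are finished when job `j` arrives. So `j`
      -- starts its own busy period, and `ℓ = 1`.
      have hbusy : JobSequence.BusyFrom J exec k j (J.arr k j + (τ k).D) := by
        refine ⟨fun s hs hst => ⟨j, hs, ?_⟩, fun q hq => ?_⟩
        · exact (JobSequence.service_mono exec k j hst.le).trans_lt (not_le.1 hmiss)
        · refine le_trans (ih q hq) (JobSequence.service_mono exec k q ?_)
          have h1 := J.arr_sep k q
          have h2 := (J.arr_strictMono k).monotone (Nat.succ_le_of_lt hq)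
          simp only [Nat.succ_eq_add_one] at h2
          linarith
      have hd : dPrime (τ k) 1 = (τ k).D := by simp [dPrime]
      exact hmiss (H.meetsDeadline_of_busyFrom hM (fun i hi => hhp i hi J exec H) le_rfl hbusy
        (ℓ := 1) (by omega) (by rw [hd]; simpa using hρ) hρ1 hS
        (by rw [hd]; simpa using hle))
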